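/- Let $\mathcal X,\mathcal Y,\mathcal Z$ be measurable spaces (for instance topological spaces with their Borel $\sigma$-algebras), let $X,Y,Z$ be random variables on a common probability space with values in $\mathcal X,\mathcal Y,\mathcal Z$, and let $P=P_{XYZ}$ be their joint law on $\mathcal X\times\mathcal Y\times\mathcal Z$ with the product $\sigma$-algebra. The Lancaster interaction measure is the finite signed measure $$\Delta_L P=P_{XYZ}-P_{XY}P_Z-P_{YZ}P_X-P_{XZ}P_Y+2P_XP_YP_Z ,$$ where products of marginal laws are regarded as measures on $\mathcal X\times\mathcal Y\times\mathcal Z$. Let $k,l,m$ be symmetric positive definite functions (kernels) on $\mathcal X,\mathcal Y,\mathcal Z$ with real values, such that $k(x,\cdot)$, $l(y,\cdot)$, $m(z,\cdot)$ are measurable for all $x,y,z$, with associated reproducing kernel Hilbert spaces $\mathcal H_k,\mathcal H_l,\mathcal H_m$, and let $(k\otimes l\otimes m)((x,y,z),(x',y',z'))=k(x,x')\,l(y,y')\,m(z,z')$. Assume that the random variables $$k(X,X)^{1/2},\quad l(Y,Y)^{1/2},\quad m(Z,Z)^{1/2}$$ as well as the products of any two of them and of all three of them are integrable (more precisely, the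 corresponding functions are integrable with respect to the corresponding marginals of $P$); this holds in particular when $k,l,m$ are bounded and jointly measurable. For a finite signed measure $\nu$ and a kernel $\kappa$, the kernel embedding $\mu_\kappa(\nu)\in\mathcal H_\kappa$ is the element with $\int F\,d\nu=\langle F,\mu_\kappa(\nu)\rangle_{\mathcal H_\kappa}$ for all $F\in\mathcal H_\kappa$ (all these integrals being absolutely convergent), and $\|\nu\|_\kappa=\|\mu_\kappa(\nu)\|_{\mathcal H_\kappa}$. Then the kernel embedding of $\Delta_LP$ into $\mathcal H_{k\otimes l\otimes m}$ exists, the three-way covariance $$\mathrm{cov}[f(X),g(Y),h(Z)]=\mathbb E\big[(f(X)-\mathbb Ef(X))(g(Y)-\mathbb Eg(Y))(h(Z)-\mathbb Eh(Z))\big]$$ is well defined (all expectations are of integrable random variables) for all $f\in\mathcal H_k$, $g\in\mathcal H_l$, $h\in\mathcal H_m$, and $$\|\Delta_LP\|_{k\otimes l\otimes m}=0\quad\Longleftrightarrow\quad \mathrm{cov}[f(X),g(Y),h(Z)]=0\ \text{ for all } f\in\mathcal H_k,\ g\in\mathcal H_l,\ h\in\mathcal H_m .$$ -/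

import Mathlib

open MeasureTheory
open scoped InnerProductSpace

noncomputable section

namespace Lancaster

/-- A real kernel on `Z`: a symmetric positive definite function `k : Z × Z → ℝ`, i.e.
`k z z' = k z' z` and `∑ i j, c i * c j * k (z i) (z j) ≥ 0` for all finite families
(`Matrix.PosSemidef` over an arbitrary index type tests finitely supported vectors). -/
structure PDKernel (Z : Type*) where
  toFun : Z → Z → ℝ
  posSemidef : (Matrix.of toFun).PosSemidef

namespace PDKernel

variable {Z W : Type*}

instance : CoeFun (PDKernel Z) (fun _ => Z → Z → ℝ) := ⟨toFun⟩

/-- The tensor product kernel `(k ⊗ l) ((z, w), (z', w')) = k (z, z') * l (w, w')`. -/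
def tensor (k : PDKernel Z) (l : PDKernel W) : PDKernel (Z × W) where
  toFun p q := k p.1 q.1 * l p.2 q.2
  posSemidef := (k.posSemidef.submatrix Prod.fst).hadamard (l.posSemidef.submatrix Prod.snd)

/-- The kernel as an operator-valued matrix: the entry at `(z, z')` is multiplication
by `k z z'` on `ℝ`. -/
def opMatrix (k : PDKernel Z) : Matrix Z Z (ℝ →L[ℝ] ℝ) :=
  Matrix.of fun z z' => k z z' • ContinuousLinearMap.id ℝ ℝ

theorem opMatrix_posSemidef (k : PDKernel Z) : k.opMatrix.PosSemidef := by
  have hsymm : ∀ x y, k x y = k y x := fun x y => by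
    have h := k.posSemidef.1.apply y x
    simpa using h
  have htfae := (RKHS.posSemidef_tfae (𝕜 := ℝ) (K := k.opMatrix)).out 0 2
  rw [htfae]
  refine ⟨?_, fun v => ?_⟩
  · refine Matrix.IsHermitian.ext fun i j => ?_
    ext
    simp [opMatrix, hsymm i j, star, ContinuousLinearMap.adjoint_id]
  · have h := k.posSemidef.2 v
    rw [Finsupp.sum_comm] at h
    simpa [opMatrix, mul_comm, mul_left_comm, mul_assoc] using h

instance (k : PDKernel Z) : Fact k.opMatrix.PosSemidef := ⟨k.opMatrix_posSemidef⟩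

/-- The reproducing kernel Hilbert space `ℋ_k` of the kernel `k`; its elements coerce to
functions `Z → ℝ`. -/
abbrev H (k : PDKernel Z) : Type _ := RKHS.OfKernel k.opMatrix

end PDKernel

/-- `e ∈ ℋ_k` is the kernel embedding of the finite signed measure `ν`: every `f ∈ ℋ_k` is
`ν`-integrable and `∫ f dν = ⟪f, e⟫`. -/
def IsKernelEmbedding {Z : Type*} [MeasurableSpace Z] (k : PDKernel Z) (ν : SignedMeasure Z)
    (e : k.H) : Prop :=
  ∀ f : k.H, ν.Integrable (fun z => f z) ∧ ∫ᵛ z, f z ∂<•ν = ⟪f, e⟫_ℝ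

theorem IsKernelEmbedding.unique {Z : Type*} [MeasurableSpace Z] {k : PDKernel Z}
    {ν : SignedMeasure Z} {e e' : k.H} (h : IsKernelEmbedding k ν e)
    (h' : IsKernelEmbedding k ν e') : e = e' :=
  ext_inner_left ℝ fun f => (h f).2.symm.trans (h' f).2

open Classical in
/-- The kernel embedding `μ_k(ν) ∈ ℋ_k` of `ν` (equal to `0` if `ν` has no embedding). -/
def kernelEmbedding {Z : Type*} [MeasurableSpace Z] (k : PDKernel Z) (ν : SignedMeasure Z) :
    k.H :=
  if h : ∃ e : k.H, IsKernelEmbedding k ν e then h.choose else 0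

/-- The RKHS norm `‖ν‖_k = ‖μ_k(ν)‖_{ℋ_k}` of a finite signed measure. -/
def rkhsNorm {Z : Type*} [MeasurableSpace Z] (k : PDKernel Z) (ν : SignedMeasure Z) : ℝ :=
  ‖kernelEmbedding k ν‖

/-- The measure `ν` satisfies `∫ k(z, z)^{1/2} dν(z) < ∞`. -/
def FiniteHalfMoment {Z : Type*} [MeasurableSpace Z] (k : PDKernel Z) (ν : Measure Z) : Prop :=
  Integrable (fun z => √(k z z)) ν

/-- The Lancaster interaction measure
`Δ_L P = P_XYZ - P_XY P_Z - P_YZ P_X - P_XZ P_Y + 2 P_X P_Y P_Z`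
of a probability law `P = P_XYZ` on `𝒳 × 𝒴 × 𝒵`. -/
def lancaster {𝒳 𝒴 𝒵 : Type*} [MeasurableSpace 𝒳] [MeasurableSpace 𝒴] [MeasurableSpace 𝒵]
    (P : Measure (𝒳 × 𝒴 × 𝒵)) [IsFiniteMeasure P] : SignedMeasure (𝒳 × 𝒴 × 𝒵) :=
  let PX : Measure 𝒳 := P.map fun p => p.1
  let PY : Measure 𝒴 := P.map fun p => p.2.1
  let PZ : Measure 𝒵 := P.map fun p => p.2.2
  let PXY : Measure (𝒳 × 𝒴) := P.map fun p => (p.1, p.2.1)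
  let PYZ : Measure (𝒴 × 𝒵) := P.map fun p => p.2
  let PXZ : Measure (𝒳 × 𝒵) := P.map fun p => (p.1, p.2.2)
  P.toSignedMeasure
    - ((PXY.prod PZ).map fun q => (q.1.1, q.1.2, q.2)).toSignedMeasure
    - (PX.prod PYZ).toSignedMeasure
    - ((PXZ.prod PY).map fun q => (q.1.1, q.2, q.1.2)).toSignedMeasure
    + (2 : ℝ) • (PX.prod (PY.prod PZ)).toSignedMeasure

section Covariance

variable {Ω : Type*} [MeasurableSpace Ω]

/-- The three-way covariance
`cov[U, V, W] = 𝔼[(U - 𝔼 U) (V - 𝔼 V) (W - 𝔼 W)]`. -/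
def cov3 (μ : Measure Ω) (U V W : Ω → ℝ) : ℝ :=
  ∫ ω, (U ω - ∫ ω', U ω' ∂μ) * (V ω - ∫ ω', V ω' ∂μ) * (W ω - ∫ ω', W ω' ∂μ) ∂μ

/-- The three-way covariance is well defined: all expectations in it are integrals of
integrable functions. -/
def HasCov3 (μ : Measure Ω) (U V W : Ω → ℝ) : Prop :=
  Integrable U μ ∧ Integrable V μ ∧ Integrable W μ ∧
    Integrable (fun ω =>
      (U ω - ∫ ω', U ω' ∂μ) * (V ω - ∫ ω', V ω' ∂μ) * (W ω - ∫ ω', W ω' ∂μ)) μ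

end Covariance

end Lancaster

end

noncomputable section

namespace Lancaster

/-! ### Reproducing property, pointwise bounds and measurability in the RKHS. -/

namespace PDKernel

variable {E F : Type*}

/-! Evaluated at `(x, y, z)`, the embedding of `Δ_L P` is the integral of `k(x,·) l(y,·) m(z,·)`
against `Δ_L P`. This function is a product, so its integral factorizes over the five terms, and the
result is exactly the expanded covariance of `k(x,X)`, `l(y,Y)`, `m(z,Z)` (`integral_lancaster_mul`,
`cov3_eq`). Hence the norm vanishes iff the covariance vanishes on kernel functions.

To reach arbitrary `f`, `g`, `h`, fix two slots. The covariance is then a bounded linear functional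
of the third, represented by a vector of its RKHS; if it kills all kernel functions, that vector is
zero (`cov3_eq_zero_of_kernel`). Doing this slot by slot avoids identifying the RKHS of the product
kernel with a Hilbert tensor product.

Existence and integrability both rest on `|f(x)| ≤ ‖f‖ k(x,x)^{1/2}` and Riesz representation. -/

theorem symm (k : PDKernel E) (x y : E) : k x y = k y x := by
  simpa using k.posSemidef.1.apply y x

/-- The kernel function `k(x, ·)` as an element of `ℋ_k`. -/
def kerVec (k : PDKernel E) (x : E) : k.H := RKHS.kerFun k.H x (1 : ℝ)

@[simp]
theorem kerVec_apply (k : PDKernel E) (x y : E) : k.kerVec x y = k x y := by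
  rw [kerVec, RKHS.kerFun_apply, RKHS.OfKernel.kernel_ofKernel, k.symm x y]
  simp [opMatrix]

theorem inner_kerVec (k : PDKernel E) (f : k.H) (x : E) : ⟪k.kerVec x, f⟫_ℝ = f x := by
  simp [kerVec]

/-- Cauchy–Schwarz for the reproducing property, with `‖k(x,·)‖² = k(x,x)`. -/
theorem abs_apply_le (k : PDKernel E) (f : k.H) (x : E) : |f x| ≤ ‖f‖ * √(k x x) := by
  have hx : k.kerVec x x = k x x := k.kerVec_apply x x
  rw [← k.inner_kerVec, real_inner_self_eq_norm_sq] at hx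
  rw [← hx, Real.sqrt_sq (norm_nonneg _), ← k.inner_kerVec, mul_comm]
  exact abs_real_inner_le_norm _ _

theorem closure_span_kerVec (k : PDKernel E) :
    (Submodule.span ℝ (Set.range k.kerVec)).topologicalClosure = ⊤ := by
  refine Submodule.orthogonal_eq_bot_iff.mp ((Submodule.eq_bot_iff _).mpr fun f hf => ?_)
  refine RKHS.ext fun x => ?_
  rw [← k.inner_kerVec f x, RKHS.coe_zero]
  exact (Submodule.mem_orthogonal _ f).1 hf _
    (Submodule.le_topologicalClosure _ (Submodule.subset_span ⟨x, rfl⟩))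

/-- A continuous linear functional on `ℋ_k` vanishing at the kernel functions is zero. -/
theorem inner_eq_zero_of_kerVec (k : PDKernel E) {e : k.H} (he : ∀ x, ⟪k.kerVec x, e⟫_ℝ = 0) :
    e = 0 :=
  RKHS.ext fun x => by rw [← k.inner_kerVec, he, RKHS.coe_zero]; rfl

theorem diag_nonneg (k : PDKernel E) (x : E) : 0 ≤ k x x := k.posSemidef.diag_nonneg

theorem sqrt_tensor (k : PDKernel E) (l : PDKernel F) (p : E × F) :
    √(k.tensor l p p) = √(k p.1 p.1) * √(l p.2 p.2) :=
  Real.sqrt_mul (k.diag_nonneg p.1) _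

variable [MeasurableSpace E] [MeasurableSpace F]

/-- Norm convergence implies pointwise convergence, so every `f` is a pointwise limit of a sequence
of finite combinations of kernel functions. Neither separability nor joint measurability of `k` is
needed. -/
theorem measurable_coe {k : PDKernel E} (hk : ∀ x, Measurable (k x)) (f : k.H) :
    Measurable (f : E → ℝ) := by
  have hspan : ∀ g ∈ Submodule.span ℝ (Set.range k.kerVec), Measurable (g : E → ℝ) := by
    intro g hg
    induction hg using Submodule.span_induction with
    | mem g hg =>
      obtain ⟨x, rfl⟩ := hg
      rw [funext (k.kerVec_apply x)]
      exact hk x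
    | zero => rw [RKHS.coe_zero]; exact measurable_const
    | add a b _ _ ha hb => rw [RKHS.coe_add]; exact ha.add hb
    | smul c a _ ha => rw [RKHS.coe_smul]; exact ha.const_smul c
  have hf : f ∈ closure (Submodule.span ℝ (Set.range k.kerVec) : Set k.H) := by
    rw [← Submodule.topologicalClosure_coe, closure_span_kerVec]
    trivial
  obtain ⟨u, hu, hlim⟩ := mem_closure_iff_seq_limit.1 hf
  refine measurable_of_tendsto_metrizable (fun n => hspan (u n) (hu n)) (tendsto_pi_nhds.2 fun x => ?_)
  exact ((RKHS.continuous_eval x).tendsto f).comp hlim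

theorem measurable_tensor {k : PDKernel E} {l : PDKernel F} (hk : ∀ x, Measurable (k x))
    (hl : ∀ y, Measurable (l y)) (p : E × F) : Measurable (k.tensor l p) :=
  ((hk p.1).comp measurable_fst).mul ((hl p.2).comp measurable_snd)

end PDKernel

/-! ### Existence and linearity of kernel embeddings. -/

section Embedding

variable {E Ω : Type*} [MeasurableSpace E] [MeasurableSpace Ω] {k : PDKernel E}

theorem integrable_coe_mul (hk : ∀ x, Measurable (k x)) {μ : Measure Ω} {X : Ω → E}
    (hX : Measurable X) {w : Ω → ℝ} (hw : AEStronglyMeasurable w μ)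
    (hkw : Integrable (fun ω => √(k (X ω) (X ω)) * w ω) μ) (f : k.H) :
    Integrable (fun ω => f (X ω) * w ω) μ := by
  refine (hkw.const_mul ‖f‖).mono
    (((PDKernel.measurable_coe hk f).comp hX).aestronglyMeasurable.mul hw) (.of_forall fun ω => ?_)
  simp only [norm_mul, Real.norm_eq_abs, abs_of_nonneg (Real.sqrt_nonneg _), abs_norm, ← mul_assoc]
  exact mul_le_mul_of_nonneg_right (k.abs_apply_le f _) (abs_nonneg _)

/-- The functional `f ↦ ∫ f(X) w dμ` on `ℋ_k` is represented by an element of `ℋ_k` as soon as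
`k(X, X)^{1/2} w` is integrable. -/
theorem exists_integral_mul_eq_inner (hk : ∀ x, Measurable (k x)) {μ : Measure Ω} {X : Ω → E}
    (hX : Measurable X) {w : Ω → ℝ} (hw : AEStronglyMeasurable w μ)
    (hkw : Integrable (fun ω => √(k (X ω) (X ω)) * w ω) μ) :
    ∃ e : k.H, ∀ f : k.H, ∫ ω, f (X ω) * w ω ∂μ = ⟪f, e⟫_ℝ := by
  have hint := integrable_coe_mul hk hX hw hkw
  let L : k.H →ₗ[ℝ] ℝ :=
    { toFun := fun f => ∫ ω, f (X ω) * w ω ∂μ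
      map_add' := fun f g => by
        rw [← integral_add (hint f) (hint g)]
        simp [add_mul]
      map_smul' := fun c f => by
        rw [RingHom.id_apply, smul_eq_mul, ← integral_const_mul]
        simp [mul_assoc] }
  have hL : ∀ f, ‖L f‖ ≤ (∫ ω, ‖√(k (X ω) (X ω)) * w ω‖ ∂μ) * ‖f‖ := by
    intro f
    rw [mul_comm, ← integral_const_mul]
    refine norm_integral_le_of_norm_le (hkw.norm.const_mul _) (.of_forall fun ω => ?_)
    simp only [norm_mul, Real.norm_eq_abs, abs_of_nonneg (Real.sqrt_nonneg _), ← mul_assoc]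
    exact mul_le_mul_of_nonneg_right (k.abs_apply_le f _) (abs_nonneg _)
  -- Riesz representation of the bounded functional.
  refine ⟨(InnerProductSpace.toDual ℝ k.H).symm (L.mkContinuous _ hL), fun f => ?_⟩
  rw [real_inner_comm, InnerProductSpace.toDual_symm_apply]
  rfl

theorem exists_isKernelEmbedding (hk : ∀ x, Measurable (k x)) {ν : Measure E} [IsFiniteMeasure ν]
    (hν : FiniteHalfMoment k ν) : ∃ e, IsKernelEmbedding k ν.toSignedMeasure e := by
  have h1 : Integrable (fun x => √(k (id x) (id x)) * (1 : ℝ)) ν := by simpa using! hν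
  obtain ⟨e, he⟩ := exists_integral_mul_eq_inner hk measurable_id aestronglyMeasurable_const h1
  refine ⟨e, fun f => ⟨?_, ?_⟩⟩
  · simpa [VectorMeasure.Integrable] using
      integrable_coe_mul hk measurable_id aestronglyMeasurable_const h1 f
  · simpa using he f

variable {ν ν' : SignedMeasure E} {e e' : k.H}

theorem IsKernelEmbedding.add (h : IsKernelEmbedding k ν e) (h' : IsKernelEmbedding k ν' e') :
    IsKernelEmbedding k (ν + ν') (e + e') := fun f =>
  ⟨(h f).1.add_vectorMeasure (h' f).1, by
    rw [VectorMeasure.integral_add_vectorMeasure (h f).1 (h' f).1, (h f).2, (h' f).2,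
      inner_add_right]⟩

theorem IsKernelEmbedding.smul (h : IsKernelEmbedding k ν e) (c : ℝ) :
    IsKernelEmbedding k (c • ν) (c • e) := fun f =>
  ⟨(h f).1.smul_vectorMeasure c, by
    rw [VectorMeasure.integral_smul_vectorMeasure, (h f).2, inner_smul_right, smul_eq_mul]⟩

theorem IsKernelEmbedding.sub (h : IsKernelEmbedding k ν e) (h' : IsKernelEmbedding k ν' e') :
    IsKernelEmbedding k (ν - ν') (e - e') := fun f =>
  ⟨(h f).1.sub_vectorMeasure (h' f).1, by
    rw [VectorMeasure.integral_sub_vectorMeasure (h f).1 (h' f).1, (h f).2, (h' f).2,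
      inner_sub_right]⟩

theorem IsKernelEmbedding.kernelEmbedding_eq (h : IsKernelEmbedding k ν e) :
    kernelEmbedding k ν = e := by
  have hex : ∃ e, IsKernelEmbedding k ν e := ⟨e, h⟩
  rw [kernelEmbedding, dif_pos hex]
  exact hex.choose_spec.unique h

/-- The integral of `k(x,·)` is the value of `e` at `x`, and an element of the RKHS is zero iff it
is zero as a function. -/
theorem rkhsNorm_eq_zero_iff (h : IsKernelEmbedding k ν e) :
    rkhsNorm k ν = 0 ↔ ∀ x, ∫ᵛ y, k x y ∂<•ν = 0 := by
  have hx : ∀ x, ∫ᵛ y, k x y ∂<•ν = ⟪k.kerVec x, e⟫_ℝ := fun x => by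
    rw [← (h _).2]
    simp only [PDKernel.kerVec_apply]
  rw [rkhsNorm, h.kernelEmbedding_eq, norm_eq_zero]
  simp only [hx]
  exact ⟨fun he x => by rw [he, inner_zero_right], k.inner_eq_zero_of_kerVec⟩

end Embedding

/-! ### Three-way covariance: integrability, expansion, extension from kernel functions. -/

section Covariance

variable {Ω : Type*} [MeasurableSpace Ω] {μ : Measure Ω} {U V W : Ω → ℝ}

/-- All products of distinct variables among `U, V, W` are integrable. -/
structure ProductsIntegrable (μ : Measure Ω) (U V W : Ω → ℝ) : Prop where
  fst : Integrable U μ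
  snd : Integrable V μ
  trd : Integrable W μ
  fst_snd : Integrable (fun ω => U ω * V ω) μ
  snd_trd : Integrable (fun ω => V ω * W ω) μ
  trd_fst : Integrable (fun ω => W ω * U ω) μ
  all : Integrable (fun ω => U ω * V ω * W ω) μ

/-- Cyclic symmetry lets results about the first slot serve for all three. -/
theorem ProductsIntegrable.rotate (h : ProductsIntegrable μ U V W) :
    ProductsIntegrable μ V W U :=
  ⟨h.snd, h.trd, h.fst, h.snd_trd, h.trd_fst, h.fst_snd,
    h.all.congr (.of_forall fun ω => by dsimp only; ring)⟩

theorem ProductsIntegrable.mono_fst (h : ProductsIntegrable μ U V W) {U' : Ω → ℝ}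
    (hU' : AEStronglyMeasurable U' μ) (C : ℝ) (hC : ∀ ω, |U' ω| ≤ C * U ω) :
    ProductsIntegrable μ U' V W := by
  have key : ∀ {T : Ω → ℝ}, AEStronglyMeasurable T μ → Integrable (fun ω => U ω * T ω) μ →
      Integrable (fun ω => U' ω * T ω) μ := fun {T} hT hUT => by
    refine (hUT.const_mul C).mono (hU'.mul hT) (.of_forall fun ω => ?_)
    rw [← mul_assoc, norm_mul, norm_mul (C * U ω)]
    exact mul_le_mul_of_nonneg_right ((hC ω).trans (le_abs_self _)) (norm_nonneg _)
  refine ⟨?_, h.snd, h.trd, key h.snd.1 h.fst_snd, h.snd_trd, ?_, ?_⟩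
  · simpa using key (T := fun _ => 1) aestronglyMeasurable_const (by simpa using h.fst)
  · simpa only [mul_comm] using key h.trd.1 (by simpa only [mul_comm] using h.trd_fst)
  · simpa only [mul_assoc] using key h.snd_trd.1 (by simpa only [mul_assoc] using h.all)

theorem ProductsIntegrable.centered_pair [IsFiniteMeasure μ] (h : ProductsIntegrable μ U V W)
    (b c : ℝ) :
    Integrable (fun ω => (V ω - b) * (W ω - c)) μ ∧
      Integrable (fun ω => U ω * ((V ω - b) * (W ω - c))) μ := by
  constructor
  · refine (((h.snd_trd.sub (h.snd.mul_const c)).sub (h.trd.const_mul b)).add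
      (integrable_const (b * c))).congr (.of_forall fun ω => ?_)
    simp only [Pi.add_apply, Pi.sub_apply]
    ring
  · refine (((h.all.sub (h.fst_snd.mul_const c)).sub (h.trd_fst.const_mul b)).add
      (h.fst.mul_const (b * c))).congr (.of_forall fun ω => ?_)
    simp only [Pi.add_apply, Pi.sub_apply]
    ring

theorem ProductsIntegrable.hasCov3 [IsFiniteMeasure μ] (h : ProductsIntegrable μ U V W) :
    HasCov3 μ U V W := by
  refine ⟨h.fst, h.snd, h.trd, ?_⟩
  have h2 := h.centered_pair (∫ ω, V ω ∂μ) (∫ ω, W ω ∂μ)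
  refine (h2.2.sub (h2.1.const_mul (∫ ω, U ω ∂μ))).congr (.of_forall fun ω => ?_)
  simp only [Pi.sub_apply]
  ring

theorem cov3_rotate (μ : Measure Ω) (U V W : Ω → ℝ) : cov3 μ U V W = cov3 μ V W U :=
  integral_congr_ae (.of_forall fun ω => by dsimp only; ring)

/-- Centering can be moved from `U` to the product `G` of the other two centered factors: `𝔼[(U -
𝔼U) G] = 𝔼[U (G - 𝔼G)]`. The right side is an integral of `U` against a weight independent of `U`,
as Riesz representation requires. -/
theorem ProductsIntegrable.cov3_eq_integral_mul [IsProbabilityMeasure μ]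
    (h : ProductsIntegrable μ U V W) :
    cov3 μ U V W = ∫ ω, U ω * ((V ω - ∫ ω', V ω' ∂μ) * (W ω - ∫ ω', W ω' ∂μ) -
      ∫ ω', (V ω' - ∫ ω', V ω' ∂μ) * (W ω' - ∫ ω', W ω' ∂μ) ∂μ) ∂μ := by
  obtain ⟨hG, hUG⟩ := h.centered_pair (∫ ω, V ω ∂μ) (∫ ω, W ω ∂μ)
  simp only [cov3, mul_assoc, sub_mul _ _ (_ * _), mul_sub (U _) (_ * _)]
  rw [integral_sub hUG (hG.const_mul _), integral_sub hUG (h.fst.mul_const _),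
    integral_const_mul, integral_mul_const]

/-- The coefficient 2 arises as 3 - 1: three terms linear in one variable, minus the constant term.
-/
theorem ProductsIntegrable.cov3_eq [IsProbabilityMeasure μ] (h : ProductsIntegrable μ U V W) :
    cov3 μ U V W = (∫ ω, U ω * V ω * W ω ∂μ) - (∫ ω, U ω * V ω ∂μ) * (∫ ω, W ω ∂μ)
      - (∫ ω, U ω ∂μ) * (∫ ω, V ω * W ω ∂μ) - (∫ ω, W ω * U ω ∂μ) * (∫ ω, V ω ∂μ)
      + 2 * ((∫ ω, U ω ∂μ) * ((∫ ω, V ω ∂μ) * (∫ ω, W ω ∂μ))) := by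
  unfold cov3
  generalize ha : ∫ ω, U ω ∂μ = a
  generalize hb : ∫ ω, V ω ∂μ = b
  generalize hc : ∫ ω, W ω ∂μ = c
  have i1 := h.all.sub (h.fst_snd.mul_const c)
  have i2 := i1.sub (h.snd_trd.const_mul a)
  have i3 := i2.sub (h.trd_fst.mul_const b)
  have i4 := i3.add (h.fst.const_mul (b * c))
  have i5 := i4.add (h.snd.const_mul (a * c))
  have i6 := i5.add (h.trd.const_mul (a * b))
  trans ∫ ω, (((((((fun ω => U ω * V ω * W ω) - fun ω => U ω * V ω * c)
    - fun ω => a * (V ω * W ω)) - fun ω => W ω * U ω * b) + fun ω => b * c * U ω)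
    + fun ω => a * c * V ω) + fun ω => a * b * W ω) ω - a * b * c ∂μ
  · refine integral_congr_ae (.of_forall fun ω => ?_)
    simp only [Pi.add_apply, Pi.sub_apply]
    ring
  rw [integral_sub i6 (integrable_const _), integral_add' i5 (h.trd.const_mul _),
    integral_add' i4 (h.snd.const_mul _), integral_add' i3 (h.fst.const_mul _),
    integral_sub' i2 (h.trd_fst.mul_const _), integral_sub' i1 (h.snd_trd.const_mul _),
    integral_sub' h.all (h.fst_snd.mul_const _)]
  simp only [integral_const_mul, integral_mul_const, integral_const, ha, hb, hc, probReal_univ,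
    one_smul]
  ring

variable {E : Type*} [MeasurableSpace E] {k : PDKernel E}

theorem ProductsIntegrable.coe_fst (hk : ∀ x, Measurable (k x)) {X : Ω → E} (hX : Measurable X)
    (h : ProductsIntegrable μ (fun ω => √(k (X ω) (X ω))) V W) (f : k.H) :
    ProductsIntegrable μ (fun ω => f (X ω)) V W :=
  h.mono_fst ((PDKernel.measurable_coe hk f).comp hX).aestronglyMeasurable ‖f‖
    fun ω => k.abs_apply_le f (X ω)

/-- The three-way covariance vanishes for all `f(X)`, `f ∈ ℋ_k`, once it vanishes for kernel
functions. -/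
theorem cov3_eq_zero_of_kernel [IsProbabilityMeasure μ] (hk : ∀ x, Measurable (k x)) {X : Ω → E}
    (hX : Measurable X) (h : ProductsIntegrable μ (fun ω => √(k (X ω) (X ω))) V W)
    (h0 : ∀ x, cov3 μ (fun ω => k x (X ω)) V W = 0) (f : k.H) :
    cov3 μ (fun ω => f (X ω)) V W = 0 := by
  obtain ⟨hG, hUG⟩ := h.centered_pair (∫ ω, V ω ∂μ) (∫ ω, W ω ∂μ)
  have hw := hG.sub (integrable_const (∫ ω', (V ω' - ∫ ω', V ω' ∂μ) * (W ω' - ∫ ω', W ω' ∂μ) ∂μ))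
  have hkw := hUG.sub (h.fst.mul_const
    (∫ ω', (V ω' - ∫ ω', V ω' ∂μ) * (W ω' - ∫ ω', W ω' ∂μ) ∂μ))
  obtain ⟨e, he⟩ := exists_integral_mul_eq_inner hk hX hw.1
    (hkw.congr (.of_forall fun ω => by simp only [Pi.sub_apply, mul_sub (√_) (_ * _)]))
  have hcov : ∀ f : k.H, cov3 μ (fun ω => f (X ω)) V W = ⟪f, e⟫_ℝ := fun f => by
    rw [(h.coe_fst hk hX f).cov3_eq_integral_mul, ← he]
    rfl
  have he0 : e = 0 := k.inner_eq_zero_of_kerVec fun x => by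
    rw [← hcov]
    simpa only [PDKernel.kerVec_apply] using h0 x
  rw [hcov, he0, inner_zero_right]

end Covariance

/-! ### Integration against the Lancaster measure. -/

section Interaction

variable {E F G : Type*} [MeasurableSpace E] [MeasurableSpace F] [MeasurableSpace G]

theorem FiniteHalfMoment.prod {k : PDKernel E} {l : PDKernel F} {ν : Measure E} {ρ : Measure F}
    [SFinite ν] [SFinite ρ] (hν : FiniteHalfMoment k ν) (hρ : FiniteHalfMoment l ρ) :
    FiniteHalfMoment (k.tensor l) (ν.prod ρ) := by
  unfold FiniteHalfMoment at *
  simp only [PDKernel.sqrt_tensor]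
  exact hν.mul_prod hρ

/-- The reordering `((x, z), y) ↦ (x, y, z)`. -/
def prodSwapRight : (E × G) × F ≃ᵐ E × F × G :=
  MeasurableEquiv.prodAssoc.trans
    ((MeasurableEquiv.refl E).prodCongr (MeasurableEquiv.prodComm (α := G) (β := F)))

/-- For a measurable embedding, integrability transfers through `map` with no measurability
condition on the integrand. This matters because `x ↦ k(x,x)` is not assumed measurable. -/
theorem measurableEmbedding_prodAssoc :
    MeasurableEmbedding (fun q : (E × F) × G => (q.1.1, q.1.2, q.2)) :=
  (MeasurableEquiv.prodAssoc (α := E) (β := F) (γ := G)).measurableEmbedding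

theorem measurableEmbedding_prodSwapRight :
    MeasurableEmbedding (fun q : (E × G) × F => (q.1.1, q.2, q.1.2)) :=
  (prodSwapRight (E := E) (F := F) (G := G)).measurableEmbedding

variable {Ω : Type*} [MeasurableSpace Ω] {μ : Measure Ω} {X : Ω → E} {Y : Ω → F} {Z : Ω → G}

theorem lancaster_map [IsFiniteMeasure μ] (hX : Measurable X) (hY : Measurable Y)
    (hZ : Measurable Z) :
    lancaster (μ.map fun ω => (X ω, Y ω, Z ω)) =
      (μ.map fun ω => (X ω, Y ω, Z ω)).toSignedMeasure
      - (((μ.map fun ω => (X ω, Y ω)).prod (μ.map Z)).map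
          fun q => (q.1.1, q.1.2, q.2)).toSignedMeasure
      - ((μ.map X).prod (μ.map fun ω => (Y ω, Z ω))).toSignedMeasure
      - (((μ.map fun ω => (X ω, Z ω)).prod (μ.map Y)).map
          fun q => (q.1.1, q.2, q.1.2)).toSignedMeasure
      + (2 : ℝ) • ((μ.map X).prod ((μ.map Y).prod (μ.map Z))).toSignedMeasure := by
  have hXYZ : Measurable fun ω => (X ω, Y ω, Z ω) := hX.prodMk (hY.prodMk hZ)
  have h1 : (μ.map fun ω => (X ω, Y ω, Z ω)).map (fun p => p.1) = μ.map X :=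
    Measure.map_map (by fun_prop) hXYZ
  have h2 : (μ.map fun ω => (X ω, Y ω, Z ω)).map (fun p => p.2.1) = μ.map Y :=
    Measure.map_map (by fun_prop) hXYZ
  have h3 : (μ.map fun ω => (X ω, Y ω, Z ω)).map (fun p => p.2.2) = μ.map Z :=
    Measure.map_map (by fun_prop) hXYZ
  have h4 : (μ.map fun ω => (X ω, Y ω, Z ω)).map (fun p => (p.1, p.2.1)) =
      μ.map fun ω => (X ω, Y ω) := Measure.map_map (by fun_prop) hXYZ
  have h5 : (μ.map fun ω => (X ω, Y ω, Z ω)).map (fun p => p.2) = μ.map fun ω => (Y ω, Z ω) :=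
    Measure.map_map (by fun_prop) hXYZ
  have h6 : (μ.map fun ω => (X ω, Y ω, Z ω)).map (fun p => (p.1, p.2.2)) =
      μ.map fun ω => (X ω, Z ω) := Measure.map_map (by fun_prop) hXYZ
  simp only [lancaster, h1, h2, h3, h4, h5, h6]

variable {k : PDKernel E} {l : PDKernel F} {m : PDKernel G}

theorem FiniteHalfMoment.prodAssoc {ν : Measure ((E × F) × G)}
    (h : FiniteHalfMoment ((k.tensor l).tensor m) ν) :
    FiniteHalfMoment (k.tensor (l.tensor m)) (ν.map fun q => (q.1.1, q.1.2, q.2)) := by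
  refine measurableEmbedding_prodAssoc.integrable_map_iff.2 (h.congr (.of_forall fun q => ?_))
  simp only [Function.comp_apply, PDKernel.sqrt_tensor, mul_assoc]

theorem FiniteHalfMoment.prodSwapRight {ν : Measure ((E × G) × F)}
    (h : FiniteHalfMoment ((k.tensor m).tensor l) ν) :
    FiniteHalfMoment (k.tensor (l.tensor m)) (ν.map fun q => (q.1.1, q.2, q.1.2)) := by
  refine measurableEmbedding_prodSwapRight.integrable_map_iff.2 (h.congr (.of_forall fun q => ?_))
  simp only [Function.comp_apply, PDKernel.sqrt_tensor]
  ring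

theorem integral_lancaster_mul [IsProbabilityMeasure μ] (hX : Measurable X) (hY : Measurable Y)
    (hZ : Measurable Z) {φ : E → ℝ} {ψ : F → ℝ} {χ : G → ℝ} (hφ : Measurable φ)
    (hψ : Measurable ψ) (hχ : Measurable χ)
    (h : ProductsIntegrable μ (fun ω => φ (X ω)) (fun ω => ψ (Y ω)) (fun ω => χ (Z ω))) :
    ∫ᵛ p, φ p.1 * (ψ p.2.1 * χ p.2.2) ∂<•(lancaster (μ.map fun ω => (X ω, Y ω, Z ω))) =
      cov3 μ (fun ω => φ (X ω)) (fun ω => ψ (Y ω)) (fun ω => χ (Z ω)) := by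
  have sX : AEStronglyMeasurable φ (μ.map X) := hφ.aestronglyMeasurable
  have sY : AEStronglyMeasurable ψ (μ.map Y) := hψ.aestronglyMeasurable
  have sZ : AEStronglyMeasurable χ (μ.map Z) := hχ.aestronglyMeasurable
  have iX : Integrable φ (μ.map X) := (integrable_map_measure sX hX.aemeasurable).2 h.fst
  have iY : Integrable ψ (μ.map Y) := (integrable_map_measure sY hY.aemeasurable).2 h.snd
  have iZ : Integrable χ (μ.map Z) := (integrable_map_measure sZ hZ.aemeasurable).2 h.trd
  have mXY : Measurable fun p : E × F => φ p.1 * ψ p.2 := by fun_prop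
  have mYZ : Measurable fun p : F × G => ψ p.1 * χ p.2 := by fun_prop
  have mXZ : Measurable fun p : E × G => φ p.1 * χ p.2 := by fun_prop
  have mXYZ : Measurable fun p : E × F × G => φ p.1 * (ψ p.2.1 * χ p.2.2) := by fun_prop
  have nXY : Measurable fun ω => (X ω, Y ω) := by fun_prop
  have nYZ : Measurable fun ω => (Y ω, Z ω) := by fun_prop
  have nXZ : Measurable fun ω => (X ω, Z ω) := by fun_prop
  have nXYZ : Measurable fun ω => (X ω, Y ω, Z ω) := by fun_prop
  have iXY : Integrable (fun p : E × F => φ p.1 * ψ p.2) (μ.map fun ω => (X ω, Y ω)) :=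
    (integrable_map_measure mXY.aestronglyMeasurable nXY.aemeasurable).2 h.fst_snd
  have iYZ : Integrable (fun p : F × G => ψ p.1 * χ p.2) (μ.map fun ω => (Y ω, Z ω)) :=
    (integrable_map_measure mYZ.aestronglyMeasurable nYZ.aemeasurable).2 h.snd_trd
  have iXZ : Integrable (fun p : E × G => φ p.1 * χ p.2) (μ.map fun ω => (X ω, Z ω)) :=
    (integrable_map_measure mXZ.aestronglyMeasurable nXZ.aemeasurable).2
      (h.trd_fst.congr (.of_forall fun ω => mul_comm _ _))
  have j1 : Integrable (fun p : E × F × G => φ p.1 * (ψ p.2.1 * χ p.2.2))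
      (μ.map fun ω => (X ω, Y ω, Z ω)) :=
    (integrable_map_measure mXYZ.aestronglyMeasurable nXYZ.aemeasurable).2
      (h.all.congr (.of_forall fun ω => mul_assoc _ _ _))
  have j2 : Integrable (fun p : E × F × G => φ p.1 * (ψ p.2.1 * χ p.2.2))
      (((μ.map fun ω => (X ω, Y ω)).prod (μ.map Z)).map fun q => (q.1.1, q.1.2, q.2)) :=
    measurableEmbedding_prodAssoc.integrable_map_iff.2
      ((iXY.mul_prod iZ).congr (.of_forall fun q => mul_assoc _ _ _))
  have j3 : Integrable (fun p : E × F × G => φ p.1 * (ψ p.2.1 * χ p.2.2))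
      ((μ.map X).prod (μ.map fun ω => (Y ω, Z ω))) := iX.mul_prod iYZ
  have j4 : Integrable (fun p : E × F × G => φ p.1 * (ψ p.2.1 * χ p.2.2))
      (((μ.map fun ω => (X ω, Z ω)).prod (μ.map Y)).map fun q => (q.1.1, q.2, q.1.2)) :=
    measurableEmbedding_prodSwapRight.integrable_map_iff.2
      ((iXZ.mul_prod iY).congr (.of_forall fun q => by simp only [Function.comp_apply]; ring))
  have j5 : Integrable (fun p : E × F × G => φ p.1 * (ψ p.2.1 * χ p.2.2))
      ((μ.map X).prod ((μ.map Y).prod (μ.map Z))) := iX.mul_prod (iY.mul_prod iZ)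
  have v1 : ∫ p, φ p.1 * (ψ p.2.1 * χ p.2.2) ∂(μ.map fun ω => (X ω, Y ω, Z ω)) =
      ∫ ω, φ (X ω) * ψ (Y ω) * χ (Z ω) ∂μ := by
    rw [integral_map nXYZ.aemeasurable mXYZ.aestronglyMeasurable]
    simp only [mul_assoc]
  have v2 : ∫ p, φ p.1 * (ψ p.2.1 * χ p.2.2) ∂(((μ.map fun ω => (X ω, Y ω)).prod (μ.map Z)).map
      fun q => (q.1.1, q.1.2, q.2)) = (∫ ω, φ (X ω) * ψ (Y ω) ∂μ) * ∫ ω, χ (Z ω) ∂μ := by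
    rw [measurableEmbedding_prodAssoc.integral_map, ← integral_map hZ.aemeasurable sZ,
      ← integral_map nXY.aemeasurable mXY.aestronglyMeasurable, ← integral_prod_mul]
    simp only [mul_assoc]
  have v3 : ∫ p, φ p.1 * (ψ p.2.1 * χ p.2.2) ∂((μ.map X).prod (μ.map fun ω => (Y ω, Z ω))) =
      (∫ ω, φ (X ω) ∂μ) * ∫ ω, ψ (Y ω) * χ (Z ω) ∂μ := by
    rw [← integral_map hX.aemeasurable sX,
      ← integral_map nYZ.aemeasurable mYZ.aestronglyMeasurable, ← integral_prod_mul]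
  have v4 : ∫ p, φ p.1 * (ψ p.2.1 * χ p.2.2) ∂(((μ.map fun ω => (X ω, Z ω)).prod (μ.map Y)).map
      fun q => (q.1.1, q.2, q.1.2)) = (∫ ω, χ (Z ω) * φ (X ω) ∂μ) * ∫ ω, ψ (Y ω) ∂μ := by
    simp only [mul_comm (χ (Z _))]
    rw [measurableEmbedding_prodSwapRight.integral_map, ← integral_map hY.aemeasurable sY,
      ← integral_map nXZ.aemeasurable mXZ.aestronglyMeasurable, ← integral_prod_mul]
    exact integral_congr_ae (.of_forall fun q => by dsimp only; ring)
  have v5 : ∫ p, φ p.1 * (ψ p.2.1 * χ p.2.2) ∂((μ.map X).prod ((μ.map Y).prod (μ.map Z))) =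
      (∫ ω, φ (X ω) ∂μ) * ((∫ ω, ψ (Y ω) ∂μ) * ∫ ω, χ (Z ω) ∂μ) := by
    rw [← integral_map hX.aemeasurable sX, ← integral_map hY.aemeasurable sY,
      ← integral_map hZ.aemeasurable sZ, ← integral_prod_mul ψ χ, ← integral_prod_mul]
  -- The variation of a positive measure is the measure itself.
  have vec : ∀ {ν : Measure (E × F × G)} [IsFiniteMeasure ν],
      Integrable (fun p : E × F × G => φ p.1 * (ψ p.2.1 * χ p.2.2)) ν →
      ν.toSignedMeasure.Integrable (fun p : E × F × G => φ p.1 * (ψ p.2.1 * χ p.2.2)) :=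
    fun hν => by simpa only [VectorMeasure.Integrable, Measure.variation_toSignedMeasure] using hν
  have w2 := (vec j1).sub_vectorMeasure (vec j2)
  have w3 := w2.sub_vectorMeasure (vec j3)
  have w4 := w3.sub_vectorMeasure (vec j4)
  rw [lancaster_map hX hY hZ,
    VectorMeasure.integral_add_vectorMeasure w4 ((vec j5).smul_vectorMeasure 2),
    VectorMeasure.integral_sub_vectorMeasure w3 (vec j4),
    VectorMeasure.integral_sub_vectorMeasure w2 (vec j3),
    VectorMeasure.integral_sub_vectorMeasure (vec j1) (vec j2),
    VectorMeasure.integral_smul_vectorMeasure]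
  simp only [VectorMeasure.integral_toSignedMeasure, v1, v2, v3, v4, v5, smul_eq_mul]
  exact h.cov3_eq.symm

end Interaction

end Lancaster

end

/-- `‖Δ_L P‖_{k ⊗ l ⊗ m} = 0` if and only if `cov[f(X), g(Y), h(Z)] = 0` for all `f ∈ ℋ_k`,
`g ∈ ℋ_l`, `h ∈ ℋ_m`, where `P` is the law of `(X, Y, Z)`; the embedding of `Δ_L P` exists and
all these covariances are well defined. -/
theorem mainTheorem3
    {Ω 𝒳 𝒴 𝒵 : Type*} [MeasurableSpace Ω]
    [MeasurableSpace 𝒳] [MeasurableSpace 𝒴] [MeasurableSpace 𝒵]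
    (μ : Measure Ω) [IsProbabilityMeasure μ]
    (X : Ω → 𝒳) (Y : Ω → 𝒴) (Z : Ω → 𝒵)
    (hX : Measurable X) (hY : Measurable Y) (hZ : Measurable Z)
    (k : Lancaster.PDKernel 𝒳) (l : Lancaster.PDKernel 𝒴) (m : Lancaster.PDKernel 𝒵)
    (hk : ∀ x, Measurable (k x)) (hl : ∀ y, Measurable (l y)) (hm : ∀ z, Measurable (m z))
    (hkX : Lancaster.FiniteHalfMoment k (μ.map X))
    (hlY : Lancaster.FiniteHalfMoment l (μ.map Y))
    (hmZ : Lancaster.FiniteHalfMoment m (μ.map Z))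
    (hXY : Lancaster.FiniteHalfMoment (k.tensor l) (μ.map fun ω => (X ω, Y ω)))
    (hYZ : Lancaster.FiniteHalfMoment (l.tensor m) (μ.map fun ω => (Y ω, Z ω)))
    (hXZ : Lancaster.FiniteHalfMoment (k.tensor m) (μ.map fun ω => (X ω, Z ω)))
    (hXYZ : Lancaster.FiniteHalfMoment (k.tensor (l.tensor m))
      (μ.map fun ω => (X ω, Y ω, Z ω))) :
    Lancaster.IsKernelEmbedding (k.tensor (l.tensor m))
      (Lancaster.lancaster (μ.map fun ω => (X ω, Y ω, Z ω)))
      (Lancaster.kernelEmbedding (k.tensor (l.tensor m))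
        (Lancaster.lancaster (μ.map fun ω => (X ω, Y ω, Z ω)))) ∧
    (∀ (f : k.H) (g : l.H) (h : m.H),
      Lancaster.HasCov3 μ (fun ω => f (X ω)) (fun ω => g (Y ω)) (fun ω => h (Z ω))) ∧
    (Lancaster.rkhsNorm (k.tensor (l.tensor m))
        (Lancaster.lancaster (μ.map fun ω => (X ω, Y ω, Z ω))) = 0 ↔
      ∀ (f : k.H) (g : l.H) (h : m.H),
        Lancaster.cov3 μ (fun ω => f (X ω)) (fun ω => g (Y ω)) (fun ω => h (Z ω)) = 0) := by
  have cX := (integrable_map_measure hkX.1 hX.aemeasurable).1 hkX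
  have cY := (integrable_map_measure hlY.1 hY.aemeasurable).1 hlY
  have cZ := (integrable_map_measure hmZ.1 hZ.aemeasurable).1 hmZ
  have cXY := (integrable_map_measure hXY.1 (hX.prodMk hY).aemeasurable).1 hXY
  have cYZ := (integrable_map_measure hYZ.1 (hY.prodMk hZ).aemeasurable).1 hYZ
  have cXZ := (integrable_map_measure hXZ.1 (hX.prodMk hZ).aemeasurable).1 hXZ
  have cXYZ := (integrable_map_measure hXYZ.1 (hX.prodMk (hY.prodMk hZ)).aemeasurable).1 hXYZ
  have hP : Lancaster.ProductsIntegrable μ (fun ω => √(k (X ω) (X ω)))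
      (fun ω => √(l (Y ω) (Y ω))) (fun ω => √(m (Z ω) (Z ω))) := by
    simp only [Function.comp_def, Lancaster.PDKernel.sqrt_tensor] at cXY cYZ cXZ cXYZ
    exact ⟨cX, cY, cZ, cXY, cYZ, cXZ.congr (.of_forall fun ω => mul_comm _ _),
      cXYZ.congr (.of_forall fun ω => (mul_assoc _ _ _).symm)⟩
  have hPf := fun f : k.H => hP.coe_fst hk hX f
  have hPfg := fun (f : k.H) (g : l.H) => (hPf f).rotate.coe_fst hl hY g
  have hPfgh := fun (f : k.H) (g : l.H) (h : m.H) =>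
    ((hPfg f g).rotate.coe_fst hm hZ h).rotate
  have hmeas := Lancaster.PDKernel.measurable_tensor hk
    (Lancaster.PDKernel.measurable_tensor hl hm)
  have hemb : ∃ e, Lancaster.IsKernelEmbedding (k.tensor (l.tensor m))
      (Lancaster.lancaster (μ.map fun ω => (X ω, Y ω, Z ω))) e := by
    rw [Lancaster.lancaster_map hX hY hZ]
    obtain ⟨e₁, h₁⟩ := Lancaster.exists_isKernelEmbedding hmeas hXYZ
    obtain ⟨e₂, h₂⟩ := Lancaster.exists_isKernelEmbedding hmeas (hXY.prod hmZ).prodAssoc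
    obtain ⟨e₃, h₃⟩ := Lancaster.exists_isKernelEmbedding hmeas (hkX.prod hYZ)
    obtain ⟨e₄, h₄⟩ := Lancaster.exists_isKernelEmbedding hmeas (hXZ.prod hlY).prodSwapRight
    obtain ⟨e₅, h₅⟩ := Lancaster.exists_isKernelEmbedding hmeas (hkX.prod (hlY.prod hmZ))
    exact ⟨_, (((h₁.sub h₂).sub h₃).sub h₄).add (h₅.smul 2)⟩
  obtain ⟨e, he⟩ := hemb
  -- By uniqueness the chosen embedding is `e`; the default value 0 does not intervene.
  refine ⟨he.kernelEmbedding_eq ▸ he, fun f g h => (hPfgh f g h).hasCov3, ?_⟩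
  have hker : ∀ x y z, ∫ᵛ p, k.tensor (l.tensor m) (x, y, z) p
        ∂<•(Lancaster.lancaster (μ.map fun ω => (X ω, Y ω, Z ω))) =
      Lancaster.cov3 μ (fun ω => k x (X ω)) (fun ω => l y (Y ω)) (fun ω => m z (Z ω)) :=
    fun x y z => Lancaster.integral_lancaster_mul hX hY hZ (hk x) (hl y) (hm z) (by
      simpa only [Lancaster.PDKernel.kerVec_apply] using
        hPfgh (k.kerVec x) (l.kerVec y) (m.kerVec z))
  rw [Lancaster.rkhsNorm_eq_zero_iff he]
  constructor
  · intro h0 f g h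
    -- Replace `f`, then `g`, then `h` by kernel functions, rotating the active slot to the front
    -- each time; the third rotation restores the original order.
    refine Lancaster.cov3_eq_zero_of_kernel hk hX (hP.rotate.coe_fst hl hY g
      |>.rotate.coe_fst hm hZ h |>.rotate) (fun x => ?_) f
    rw [Lancaster.cov3_rotate]
    have hPx := by simpa only [Lancaster.PDKernel.kerVec_apply] using hPf (k.kerVec x)
    refine Lancaster.cov3_eq_zero_of_kernel hl hY
      (hPx.rotate.rotate.coe_fst hm hZ h).rotate.rotate (fun y => ?_) g
    rw [Lancaster.cov3_rotate]
    have hPxy := by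
      simpa only [Lancaster.PDKernel.kerVec_apply] using hPfg (k.kerVec x) (l.kerVec y)
    refine Lancaster.cov3_eq_zero_of_kernel hm hZ hPxy.rotate (fun z => ?_) h
    rw [Lancaster.cov3_rotate, ← hker]
    exact h0 (x, y, z)
  · rintro h0 ⟨x, y, z⟩
    rw [hker]
    simpa only [Lancaster.PDKernel.kerVec_apply] using
      h0 (k.kerVec x) (l.kerVec y) (m.kerVec z)
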